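/- Call a family $\mathcal M$ of infinite subsets of $\mathbb N$ almost disjoint if any two distinct members of $\mathcal M$ have finite intersection, and a MAD family if it is maximal with respect to inclusion among almost disjoint families. For such $\mathcal M$, the Isbell–Mrówka space $\Psi(\mathcal M)$ has underlying set the disjoint union $\mathbb N\sqcup\mathcal M$; the points of $\mathbb N$ are isolated, and the sets $\{A\}\cup B$ with $B\subseteq\mathbb N$ and $A\setminus B$ finite form a base of neighborhoods of $A\in\mathcal M$. A topological space $Z$ is a $\Delta$-space if for every decreasing sequence $(D_n)_{n\in\mathbb N}$ of subsets of $Z$ with $\bigcap_n D_n=\emptyset$ there is a decreasing sequence $(V_n)_{n\in\mathbb N}$ of open subsets of $Z$ with $\bigcap_n V_n=\emptyset$ and $D_n\subseteq V_n$ for every $n$. A Tychonoff space is pseudocompact if every continuous real-valued function on it is bounded. A space $Z$ has countable tightness at $p\in Z$ if whenever $p$ is in the closure of a set $Y\subseteq Z$, there is a countable $B\subseteq Y$ with $p$ in the closure of $B$; otherwise it has uncountable tightness at $p$. **Theorem.** There are a MAD family $\mathcal M$ of subsets of $\mathbb N$ and, for $X=\Psi(\mathcal M)$ with Stone–Čech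 compactification $\beta X$, a point $p\in\beta X\setminus X$ such that the subspace $X_p=X\cup\{p\}$ of $\beta X$ is a pseudocompact $\Delta$-space and has uncountable tightness at $p$. -/

import Mathlib

open Set Topology

/-- An almost disjoint family on `ℕ`: a family of infinite subsets of `ℕ`, any two distinct
members of which have finite intersection. -/
def IsAlmostDisjoint (M : Set (Set ℕ)) : Prop :=
  (∀ A ∈ M, A.Infinite) ∧ ∀ A ∈ M, ∀ B ∈ M, A ≠ B → (A ∩ B).Finite

/-- A maximal almost disjoint family on `ℕ`: maximal with respect to inclusion among the almost
disjoint families. -/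
def IsMAD (M : Set (Set ℕ)) : Prop := Maximal IsAlmostDisjoint M

/-- The underlying set of `Ψ(M)`: the disjoint union of `ℕ` and `M`. -/
inductive PsiSpace (M : Set (Set ℕ)) : Type
  | ofNat : ℕ → PsiSpace M
  | ofMem : M → PsiSpace M

/-- The topology of `Ψ(M)`: the points of `ℕ` are isolated, and the sets `{A} ∪ B` with
`B ⊆ ℕ` and `A \ B` finite form a base of neighborhoods of `A ∈ M`. So `U` is open if and only
if, for each point `A ∈ M` of `U`, all but finitely many elements of `A` belong to `U`. -/
instance PsiSpace.instTopologicalSpace (M : Set (Set ℕ)) : TopologicalSpace (PsiSpace M) where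
  IsOpen U := ∀ A : M, PsiSpace.ofMem A ∈ U →
    {n : ℕ | n ∈ A.1 ∧ PsiSpace.ofNat n ∉ U}.Finite
  isOpen_univ := by intro A _; simp
  isOpen_inter := by
    intro s t hs ht A hA
    refine ((hs A hA.1).union (ht A hA.2)).subset ?_
    rintro n ⟨hn, hnU⟩
    by_cases h : PsiSpace.ofNat n ∈ s
    · exact Or.inr ⟨hn, fun h' => hnU ⟨h, h'⟩⟩
    · exact Or.inl ⟨hn, h⟩
  isOpen_sUnion := by
    rintro S hS A ⟨t, ht, hA⟩
    exact (hS t ht A hA).subset fun n hn => ⟨hn.1, fun h => hn.2 ⟨t, ht, h⟩⟩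

/-- `X` is a Δ-space: every decreasing sequence of subsets of `X` with empty intersection has a
decreasing open expansion with empty intersection. -/
def IsDeltaSpace (X : Type*) [TopologicalSpace X] : Prop :=
  ∀ D : ℕ → Set X, Antitone D → ⋂ n, D n = ∅ →
    ∃ V : ℕ → Set X, Antitone V ∧ (∀ n, IsOpen (V n)) ∧ ⋂ n, V n = ∅ ∧ ∀ n, D n ⊆ V n

/-- `X` is pseudocompact: it is Tychonoff and every continuous real function on it is bounded. -/
def IsPseudocompact (X : Type*) [TopologicalSpace X] : Prop :=
  T35Space X ∧ ∀ f : X → ℝ, Continuous f → Bornology.IsBounded (range f)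

/-- `X` has countable tightness at `p`. -/
def HasCountableTightnessAt (X : Type*) [TopologicalSpace X] (p : X) : Prop :=
  ∀ Y : Set X, p ∈ closure Y → ∃ B ⊆ Y, B.Countable ∧ p ∈ closure B

/-- The subspace `X ∪ {p}` of the Stone–Čech compactification `βX` of `X`, where `X` is identified
with its image in `βX`. -/
abbrev OnePointExtension (X : Type*) [TopologicalSpace X] (p : StoneCech X) : Type _ :=
  (insert p (range (stoneCechUnit : X → StoneCech X)) : Set (StoneCech X))

/-! Let `B` be an `ω₁`-tower: strictly increasing modulo finite sets. Densely many infinite sets are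
decided by every `B w` (`exists_subset_decidedBy`), so some MAD family `M` consists of such sets.
Let `Y w` be the set of members almost contained in `B w`. The `Y w` increase, no `Y w` exhausts
their union `Y`, and decidedness makes each one separable by a clopen set from `Y \ Y w`
(`isClopen_of_decided`). Compactness of `βX` gives `p` in the closure of every `Y \ Y w`, hence
outside the closure of every `Y w` (`exists_remainder_point`). A countable subset of `Y` lies in a
single `Y w`, so tightness at `p` is uncountable.

The other two properties hold for every `p`: maximality bounds continuous functions, and the
Δ-property uses only that `ℕ` is countable with subsets of `M` becoming open once a cofinite part of
`ℕ` is added. -/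

open Filter

/-! ### Towers and MAD families decided by them -/

/-- A countable chain of co-infinite sets, ordered by inclusion modulo finite sets, has a strict
co-infinite upper bound. -/
theorem exists_almost_extension {ι : Type*} [LinearOrder ι] [Countable ι] (B : ι → Set ℕ)
    (hB : ∀ i, (B i)ᶜ.Infinite) (hmono : ∀ i j, i < j → (B i \ B j).Finite) :
    ∃ C : Set ℕ, Cᶜ.Infinite ∧ ∀ i, (B i \ C).Finite ∧ (C \ B i).Infinite := by
  rcases isEmpty_or_nonempty ι with h | h
  · exact ⟨∅, by simpa using Set.infinite_univ, fun i => (IsEmpty.false i).elim⟩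
  -- `G i` describes escaping to infinity outside `B i`. A sequence tending to the infimum of these
  -- filters diagonalises against all `B i` at once.
  let G : ι → Filter ℕ := fun i => 𝓟 (B i)ᶜ ⊓ atTop
  have hG : ∀ i, (G i).NeBot := fun i => by
    change (𝓟 (B i)ᶜ ⊓ atTop).NeBot
    rw [inf_comm, ← frequently_mem_iff_neBot, Nat.frequently_atTop_iff_infinite]
    exact hB i
  have hle : ∀ i j, i ≤ j → G j ≤ G i := by
    intro i j hij
    rcases hij.eq_or_lt with rfl | hij
    · exact le_rfl
    refine le_inf ?_ inf_le_right
    rw [le_principal_iff]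
    change (B i)ᶜ ∈ 𝓟 (B j)ᶜ ⊓ atTop
    rw [inf_comm, mem_inf_principal, ← Nat.cofinite_eq_atTop]
    refine (hmono i j hij).subset fun n hn => ?_
    simp only [mem_compl_iff, mem_ofPred_eq, not_forall, not_not] at hn
    exact ⟨hn.2, hn.1⟩
  have hne : (⨅ i, G i).NeBot :=
    iInf_neBot_of_directed' (directed_of_isDirected_le fun i j hij => hle i j hij) hG
  have : (⨅ i, G i).IsCountablyGenerated := inferInstance
  obtain ⟨k, hk⟩ := exists_seq_tendsto (⨅ i, G i)
  have hk' : Tendsto k atTop atTop :=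
    hk.mono_right ((iInf_le _ (Classical.arbitrary ι)).trans inf_le_right)
  obtain ⟨φ, hφ, hj⟩ := strictMono_subseq_of_tendsto_atTop hk'
  have hfin : ∀ i, {n | (k ∘ φ) n ∈ B i}.Finite := by
    intro i
    have h1 : Tendsto (k ∘ φ) atTop (𝓟 (B i)ᶜ) :=
      (hk.comp hφ.tendsto_atTop).mono_right ((iInf_le _ i).trans inf_le_left)
    have h2 := tendsto_principal.1 h1
    rw [← Nat.cofinite_eq_atTop] at h2
    simpa [eventually_cofinite] using h2
  generalize k ∘ φ = j at hj hfin
  -- Removing only the even-indexed terms keeps `C` co-infinite, while the odd-indexed terms witness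
  -- that `C \ B i` is infinite.
  refine ⟨(range fun n => j (2 * n))ᶜ, ?_, fun i => ⟨?_, ?_⟩⟩
  · rw [compl_compl]
    exact infinite_range_of_injective fun a b hab => by
      have := hj.injective hab
      omega
  · refine ((hfin i).image j).subset ?_
    rintro n ⟨hn, hn'⟩
    obtain ⟨m, rfl⟩ := not_not.1 hn'
    exact ⟨2 * m, hn, rfl⟩
  · have hodd : {n | n % 2 = 1}.Infinite := by
      refine (infinite_range_of_injective (f := fun n : ℕ => 2 * n + 1) fun a b h => ?_).mono ?_
      · simp only at h
        omega
      · rintro _ ⟨n, rfl⟩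
        simp only [mem_ofPred_eq]
        omega
    refine ((hodd.sdiff (hfin i)).image hj.injective.injOn).mono ?_
    rintro _ ⟨n, ⟨hn, hn'⟩, rfl⟩
    refine ⟨?_, hn'⟩
    rintro ⟨m, hm⟩
    have := hj.injective hm
    simp only [mem_ofPred_eq] at hn
    omega

/-- A strictly increasing tower modulo finite sets, indexed by a well-order with countable initial
segments. -/
theorem exists_tower (W : Type*) [LinearOrder W] [WellFoundedLT W]
    (hW : ∀ w : W, Countable (Iio w)) :
    ∃ B : W → Set ℕ, ∀ a b, a < b → (B a \ B b).Finite ∧ (B b \ B a).Infinite := by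
  classical
  let step : ∀ w : W, (∀ v, v < w → Set ℕ) → Set ℕ := fun w prev =>
    if h : ∃ C : Set ℕ, Cᶜ.Infinite ∧
        ∀ v (hv : v < w), (prev v hv \ C).Finite ∧ (C \ prev v hv).Infinite
    -- The default is never used: `key` shows by induction that the extension exists at every stage.
    then h.choose else ∅
  let B : W → Set ℕ := (wellFounded_lt (α := W)).fix step
  have hfix : ∀ w, B w = step w fun v _ => B v := fun w => WellFounded.fix_eq _ _ _
  have key : ∀ w, (B w)ᶜ.Infinite ∧ ∀ v < w, (B v \ B w).Finite ∧ (B w \ B v).Infinite := by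
    intro w
    induction w using WellFoundedLT.induction with
    | ind w ih =>
      have := hW w
      have hex : ∃ C : Set ℕ, Cᶜ.Infinite ∧
          ∀ v (_ : v < w), (B v \ C).Finite ∧ (C \ B v).Infinite := by
        obtain ⟨C, hC, hC'⟩ := exists_almost_extension (fun v : Iio w => B v)
          (fun v => (ih v v.2).1) (fun u v huv => ((ih v v.2).2 u huv).1)
        exact ⟨C, hC, fun v hv => hC' ⟨v, hv⟩⟩
      have hB : B w = hex.choose := by
        rw [hfix]
        exact dif_pos hex
      rw [hB]
      exact hex.choose_spec
  exact ⟨B, fun a b hab => (key b).2 a hab⟩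

/-- If every infinite set has an infinite subset satisfying `P`, then there is a maximal almost
disjoint family of sets satisfying `P`. -/
theorem exists_isMAD_of_dense (P : Set ℕ → Prop)
    (hP : ∀ S : Set ℕ, S.Infinite → ∃ A ⊆ S, A.Infinite ∧ P A) :
    ∃ M, IsMAD M ∧ ∀ A ∈ M, P A := by
  obtain ⟨M, hM⟩ := zorn_subset {M | IsAlmostDisjoint M ∧ ∀ A ∈ M, P A} (by
    intro c hc hchain
    refine ⟨⋃₀ c, ⟨⟨?_, ?_⟩, ?_⟩, fun s hs => subset_sUnion_of_mem hs⟩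
    · rintro A ⟨s, hs, hA⟩
      exact (hc hs).1.1 A hA
    · rintro A ⟨s, hs, hA⟩ A' ⟨t, ht, hA'⟩ hne
      rcases hchain.total hs ht with h | h
      · exact (hc ht).1.2 A (h hA) A' hA' hne
      · exact (hc hs).1.2 A hA A' (h hA') hne
    · rintro A ⟨s, hs, hA⟩
      exact (hc hs).2 A hA)
  refine ⟨M, ⟨hM.prop.1, fun N hN hMN S hS => ?_⟩, hM.prop.2⟩
  by_contra hSM
  obtain ⟨A, hAS, hA, hPA⟩ := hP S (hN.1 S hS)
  have hfin : ∀ A' ∈ M, (A ∩ A').Finite := fun A' hA' =>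
    (hN.2 S hS A' (hMN hA') (fun h => hSM (h ▸ hA'))).subset (inter_subset_inter_left _ hAS)
  have hins : insert A M ∈ {M | IsAlmostDisjoint M ∧ ∀ A ∈ M, P A} := by
    refine ⟨⟨?_, ?_⟩, ?_⟩
    · rintro A' (rfl | h)
      exacts [hA, hM.prop.1.1 _ h]
    · rintro A₁ (rfl | h₁) A₂ (rfl | h₂) hne
      · exact (hne rfl).elim
      · exact hfin _ h₂
      · rw [inter_comm]
        exact hfin _ h₁
      · exact hM.prop.1.2 _ h₁ _ h₂ hne
    · rintro A' (rfl | h)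
      exacts [hPA, hM.prop.2 _ h]
  have hAM : A ∈ M := hM.le_of_ge hins (subset_insert _ _) (mem_insert _ _)
  exact hA (by simpa using hfin A hAM)

/-- Every infinite set has infinite intersection with some member of a maximal almost disjoint
family. -/
theorem IsMAD.exists_inter_infinite {M : Set (Set ℕ)} (hM : IsMAD M) {S : Set ℕ}
    (hS : S.Infinite) : ∃ A ∈ M, (A ∩ S).Infinite := by
  by_contra! h
  have hins : IsAlmostDisjoint (insert S M) := by
    refine ⟨?_, ?_⟩
    · rintro A' (rfl | h')
      exacts [hS, hM.prop.1 _ h']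
    · rintro A₁ (rfl | h₁) A₂ (rfl | h₂) hne
      · exact (hne rfl).elim
      · rw [inter_comm]
        exact h _ h₂
      · exact h _ h₁
      · exact hM.prop.2 _ h₁ _ h₂ hne
  have hSM : S ∈ M := hM.le_of_ge hins (subset_insert _ _) (mem_insert _ _)
  exact hS (by simpa using h S hSM)

/-- A set which is almost contained in or almost disjoint from `B`. -/
def DecidedBy (A B : Set ℕ) : Prop := (A \ B).Finite ∨ (A ∩ B).Finite

/-- For the least `w` with `S ∩ B w` infinite, this intersection is almost disjoint from earlier
sets of the tower and almost contained in later ones. If there is no such `w`, then `S` itself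
works. -/
theorem exists_subset_decidedBy {W : Type*} [LinearOrder W] [WellFoundedLT W] {B : W → Set ℕ}
    (hB : ∀ a b, a < b → (B a \ B b).Finite) {S : Set ℕ} (hS : S.Infinite) :
    ∃ A ⊆ S, A.Infinite ∧ ∀ w, DecidedBy A (B w) := by
  by_cases h : ∃ w, (S ∩ B w).Infinite
  · obtain ⟨w, hw, hmin⟩ := (wellFounded_lt (α := W)).has_min {w | (S ∩ B w).Infinite} h
    refine ⟨S ∩ B w, inter_subset_left, hw, fun v => ?_⟩
    rcases lt_trichotomy v w with hv | rfl | hv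
    · exact Or.inr ((not_infinite.1 fun hinf => hmin v hinf hv).subset
        (inter_subset_inter_left _ inter_subset_left))
    · exact Or.inl (finite_empty.subset fun n hn => hn.2 hn.1.2)
    · exact Or.inl ((hB w v hv).subset fun n hn => ⟨hn.1.2, hn.2⟩)
  · push Not at h
    exact ⟨S, subset_rfl, hS, fun w => Or.inr (h w)⟩

/-! ### Clopen sets and the Stone–Čech compactification -/

section StoneCechOpen

variable {X : Type*} [TopologicalSpace X]

theorem isOpenEmbedding_stoneCechUnit_of_compact_clopen [T1Space X]
    (h : ∀ x : X, ∀ U : Set X, IsOpen U → x ∈ U → ∃ K ⊆ U, x ∈ K ∧ IsClopen K ∧ IsCompact K) :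
    IsOpenEmbedding (stoneCechUnit : X → StoneCech X) := by
  classical
  refine .of_continuous_injective_isOpenMap continuous_stoneCechUnit ?_ ?_
  · intro x y hxy
    by_contra hne
    obtain ⟨K, hK, hxK, hclopen, -⟩ := h x {y}ᶜ isOpen_compl_singleton hne
    have := eq_if_stoneCechUnit_eq ((continuous_boolIndicator_iff_isClopen K).2 hclopen) hxy
    rw [(mem_iff_boolIndicator K x).1 hxK] at this
    exact hK ((mem_iff_boolIndicator K y).2 this.symm) rfl
  · intro U hU
    rw [isOpen_iff_forall_mem_open]
    rintro _ ⟨x, hx, rfl⟩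
    obtain ⟨K, hKU, hxK, hclopen, hcomp⟩ := h x U hU hx
    have hg := (continuous_boolIndicator_iff_isClopen K).2 hclopen
    have hopen : IsOpen (stoneCechExtend hg ⁻¹' {true}) :=
      (isOpen_discrete _).preimage (continuous_stoneCechExtend hg)
    refine ⟨stoneCechExtend hg ⁻¹' {true}, ?_, hopen, ?_⟩
    -- By density, the open set lies in the closure of its trace on `X`, which is the image of `K`;
    -- that image is compact, hence already closed.
    · refine Subset.trans ?_ (image_mono hKU)
      refine (denseRange_stoneCechUnit.open_subset_closure_inter hopen).trans ?_
      refine closure_minimal ?_ (hcomp.image continuous_stoneCechUnit).isClosed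
      rintro _ ⟨hy, y, rfl⟩
      rw [mem_preimage, stoneCechExtend_stoneCechUnit] at hy
      exact ⟨y, (mem_iff_boolIndicator K y).2 hy, rfl⟩
    · rw [mem_preimage, stoneCechExtend_stoneCechUnit]
      exact (mem_iff_boolIndicator K x).1 hxK

/-- The indicator of `K` extends continuously to `βX` and separates the two closures. -/
theorem disjoint_closure_image_stoneCechUnit {K : Set X} (hK : IsClopen K) {S T : Set X}
    (hS : S ⊆ K) (hT : Disjoint T K) :
    Disjoint (closure (stoneCechUnit '' S)) (closure (stoneCechUnit '' T)) := by
  classical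
  have hg := (continuous_boolIndicator_iff_isClopen K).2 hK
  have hc := continuous_stoneCechExtend hg
  have h1 : closure (stoneCechUnit '' S) ⊆ stoneCechExtend hg ⁻¹' {true} := by
    refine closure_minimal ?_ ((isClosed_discrete _).preimage hc)
    rintro _ ⟨x, hx, rfl⟩
    rw [mem_preimage, stoneCechExtend_stoneCechUnit]
    exact (mem_iff_boolIndicator K x).1 (hS hx)
  have h2 : closure (stoneCechUnit '' T) ⊆ stoneCechExtend hg ⁻¹' {false} := by
    refine closure_minimal ?_ ((isClosed_discrete _).preimage hc)
    rintro _ ⟨x, hx, rfl⟩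
    rw [mem_preimage, stoneCechExtend_stoneCechUnit]
    exact (notMem_iff_boolIndicator K x).1 (disjoint_left.1 hT hx)
  refine Disjoint.mono h1 h2 (Disjoint.preimage _ ?_)
  simp

end StoneCechOpen

/-! ### Isbell–Mrówka spaces and their one-point extensions -/

namespace PsiSpace

variable {M : Set (Set ℕ)}

theorem isOpen_iff {U : Set (PsiSpace M)} :
    IsOpen U ↔ ∀ A : M, ofMem A ∈ U → {n : ℕ | n ∈ A.1 ∧ ofNat n ∉ U}.Finite := Iff.rfl

theorem isOpen_of_forall_ofMem_notMem {U : Set (PsiSpace M)} (h : ∀ A, ofMem A ∉ U) :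
    IsOpen U := fun A hA => (h A hA).elim

theorem isOpen_insert_range_ofNat (x : PsiSpace M) : IsOpen (insert x (range ofNat)) :=
  fun _ _ => finite_empty.subset fun n hn => hn.2 (mem_insert_of_mem _ (mem_range_self n))

instance : T1Space (PsiSpace M) where
  t1 x := by
    refine ⟨fun A _ => Set.Subsingleton.finite fun m hm n hn => ?_⟩
    have h : (ofNat m : PsiSpace M) = ofNat n := (not_not.1 hm.2).trans (not_not.1 hn.2).symm
    cases h
    rfl

/-- The complement is open because a member not almost contained in `B` must be almost disjoint from
it. -/
theorem isClopen_of_decided (B : Set ℕ) (h : ∀ A ∈ M, DecidedBy A B) :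
    IsClopen (ofNat '' B ∪ {x : PsiSpace M | ∃ A : M, x = ofMem A ∧ (A.1 \ B).Finite}) := by
  refine ⟨⟨fun A hA => ?_⟩, fun A hA => ?_⟩
  · have hA' : ¬ (A.1 \ B).Finite := fun hf => hA (Or.inr ⟨A, rfl, hf⟩)
    refine ((h A A.2).resolve_left hA').subset ?_
    rintro n ⟨hn, hn'⟩
    rcases not_not.1 hn' with ⟨m, hm, hmn⟩ | ⟨A', h', -⟩
    · cases hmn
      exact ⟨hn, hm⟩
    · cases h'
  · rcases hA with ⟨m, -, hm⟩ | ⟨A', h', hf⟩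
    · cases hm
    · cases h'
      exact hf.subset fun n hn => ⟨hn.1, fun hB => hn.2 (Or.inl ⟨n, hB, rfl⟩)⟩

theorem exists_compact_clopen_subset (hM : IsAlmostDisjoint M) (x : PsiSpace M)
    (U : Set (PsiSpace M)) (hU : IsOpen U) (hx : x ∈ U) :
    ∃ K ⊆ U, x ∈ K ∧ IsClopen K ∧ IsCompact K := by
  cases x with
  | ofNat n =>
    refine ⟨{ofNat n}, singleton_subset_iff.2 hx, rfl, ⟨isClosed_singleton, ?_⟩,
      isCompact_singleton⟩
    exact isOpen_of_forall_ofMem_notMem fun A hA => by cases hA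
  | ofMem A =>
    have hfin := isOpen_iff.1 hU A hx
    let K : Set (PsiSpace M) := insert (ofMem A) (ofNat '' {n | n ∈ A.1 ∧ ofNat n ∈ U})
    have hA : ofMem A ∈ K := mem_insert _ _
    have hsub : ∀ V : Set (PsiSpace M), IsOpen V → ofMem A ∈ V → (K \ V).Finite := by
      intro V hV hAV
      refine ((isOpen_iff.1 hV A hAV).image ofNat).subset ?_
      rintro _ ⟨rfl | ⟨n, hn, rfl⟩, h⟩
      · exact (h hAV).elim
      · exact ⟨n, ⟨hn.1, h⟩, rfl⟩
    refine ⟨K, ?_, hA, ⟨⟨?_⟩, ?_⟩, ?_⟩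
    · rintro _ (rfl | ⟨n, hn, rfl⟩)
      exacts [hx, hn.2]
    · intro A' hA'
      have hne : A' ≠ A := by
        rintro rfl
        exact hA' hA
      refine (hM.2 A' A'.2 A A.2 (fun h => hne (Subtype.ext h))).subset ?_
      rintro n ⟨hn, hn'⟩
      rcases not_not.1 hn' with h | ⟨m, hm, hmn⟩
      · cases h
      · cases hmn
        exact ⟨hn, hm.1⟩
    · rintro A' (h | ⟨m, -, hm⟩)
      · cases h
        exact hfin.subset fun n hn => ⟨hn.1, fun hn' => hn.2 (Or.inr ⟨n, ⟨hn.1, hn'⟩, rfl⟩)⟩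
      · cases hm
    · refine isCompact_of_finite_subcover fun {ι} V hV hcov => ?_
      obtain ⟨i, hi⟩ := mem_iUnion.1 (hcov hA)
      have hf := hsub (V i) (hV i) hi
      obtain ⟨t, ht⟩ := hf.isCompact.elim_finite_subcover V hV (sdiff_subset.trans hcov)
      classical
      refine ⟨insert i t, fun y hy => ?_⟩
      by_cases hyi : y ∈ V i
      · exact mem_biUnion (Finset.mem_insert_self i t) hyi
      · obtain ⟨j, hj, hyj⟩ := mem_iUnion₂.1 (ht ⟨hy, hyi⟩)
        exact mem_biUnion (Finset.mem_insert_of_mem hj) hyj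

theorem isOpenEmbedding_stoneCechUnit (hM : IsAlmostDisjoint M) :
    IsOpenEmbedding (stoneCechUnit : PsiSpace M → StoneCech (PsiSpace M)) :=
  isOpenEmbedding_stoneCechUnit_of_compact_clopen (exists_compact_clopen_subset hM)

theorem denseRange_ofNat (hM : IsAlmostDisjoint M) : DenseRange (ofNat : ℕ → PsiSpace M) := by
  intro x
  cases x with
  | ofNat n => exact subset_closure (mem_range_self n)
  | ofMem A =>
    rw [mem_closure_iff]
    intro U hU hA
    obtain ⟨n, hn, hn'⟩ := ((hM.1 A A.2).sdiff (isOpen_iff.1 hU A hA)).nonempty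
    exact ⟨ofNat n, by_contra fun h => hn' ⟨hn, h⟩, mem_range_self n⟩

/-- If `f` is unbounded on `ℕ`, then `|f|` tends to infinity along some sequence in `ℕ`; a member of
`M` meeting its range infinitely contradicts continuity at that member. -/
theorem isBounded_range (hM : IsMAD M) {f : PsiSpace M → ℝ} (hf : Continuous f) :
    Bornology.IsBounded (range f) := by
  by_cases hb : ∃ k : ℕ, ∀ n, |f (ofNat n)| ≤ k
  · obtain ⟨k, hk⟩ := hb
    refine (isBounded_iff_forall_norm_le.2 ⟨k, ?_⟩)
    rintro _ ⟨x, rfl⟩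
    have hcl : IsClosed {x | ‖f x‖ ≤ k} := isClosed_le hf.norm continuous_const
    refine hcl.closure_subset_iff.2 ?_ (denseRange_ofNat hM.prop x)
    rintro _ ⟨n, rfl⟩
    exact hk n
  · exfalso
    push Not at hb
    have hfreq : ∀ k : ℕ, ∃ᶠ n in atTop, (k : ℝ) < |f (ofNat n)| := by
      intro k
      rw [frequently_atTop]
      intro N
      by_contra! hN
      obtain ⟨c, hc⟩ := ((finite_lt_nat N).image fun n => |f (ofNat n)|).bddAbove
      obtain ⟨m, hm⟩ := exists_nat_ge (max c k)
      obtain ⟨n, hn⟩ := hb m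
      rcases lt_or_ge n N with h | h
      · exact absurd (hc ⟨n, h, rfl⟩) (not_le.2 ((le_max_left _ _).trans_lt (hm.trans_lt hn)))
      · exact absurd (hN n h) (not_le.2 ((le_max_right _ _).trans_lt (hm.trans_lt hn)))
    obtain ⟨φ, hφ, hlt⟩ := extraction_forall_of_frequently hfreq
    obtain ⟨A, hA, hinf⟩ := hM.exists_inter_infinite (infinite_range_of_injective hφ.injective)
    obtain ⟨m, hm⟩ := exists_nat_gt |f (ofMem ⟨A, hA⟩)|
    have hfin := isOpen_iff.1 (isOpen_Iio.preimage hf.abs : IsOpen {x | |f x| < m}) ⟨A, hA⟩ hm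
    refine hinf ((hfin.union ((finite_lt_nat m).image φ)).subset ?_)
    rintro _ ⟨hn, k, rfl⟩
    rcases lt_or_ge k m with h | h
    · exact Or.inr ⟨k, h, rfl⟩
    · refine Or.inl ⟨hn, fun h' => ?_⟩
      have h1 : |f (ofNat (φ k))| < m := h'
      have h2 : (m : ℝ) ≤ k := by exact_mod_cast h
      exact lt_asymm (hlt k) (h1.trans_le h2)

/-- The inclusion of `Ψ(M)` into a one-point extension of it. -/
def toExtension (p : StoneCech (PsiSpace M)) (x : PsiSpace M) : OnePointExtension (PsiSpace M) p :=
  ⟨stoneCechUnit x, Or.inr (mem_range_self x)⟩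

theorem continuous_toExtension (p : StoneCech (PsiSpace M)) : Continuous (toExtension p) :=
  continuous_stoneCechUnit.subtype_mk _

theorem isPseudocompact_extension (hM : IsMAD M) (p : StoneCech (PsiSpace M)) :
    IsPseudocompact (OnePointExtension (PsiSpace M) p) := by
  refine ⟨inferInstance, fun f hf => ?_⟩
  have hbd := isBounded_range hM (hf.comp (continuous_toExtension p))
  have hrange : range f ⊆ insert (f ⟨p, mem_insert _ _⟩) (range (f ∘ toExtension p)) := by
    rintro _ ⟨⟨y, rfl | ⟨x, rfl⟩⟩, rfl⟩
    · exact mem_insert _ _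
    · exact Or.inr ⟨x, rfl⟩
  exact (hbd.insert _).subset hrange

theorem isDeltaSpace_extension (hM : IsAlmostDisjoint M) (p : StoneCech (PsiSpace M)) :
    IsDeltaSpace (OnePointExtension (PsiSpace M) p) := by
  intro D hD hempty
  have hemb := isOpenEmbedding_stoneCechUnit hM
  have hinj : Function.Injective (toExtension p) := fun x y h =>
    hemb.injective (congrArg Subtype.val h)
  have hopen : IsOpenMap (toExtension p) := fun U hU => by
    refine ⟨stoneCechUnit '' U, hemb.isOpenMap U hU, ?_⟩
    ext y
    constructor
    · rintro ⟨x, hx, hxy⟩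
      exact ⟨x, hx, Subtype.ext hxy⟩
    · rintro ⟨x, hx, rfl⟩
      exact ⟨x, hx, rfl⟩
  have hlast : ∀ y, ∃ N, ∀ n, N ≤ n → y ∉ D n := by
    intro y
    have hy : y ∉ ⋂ n, D n := hempty ▸ notMem_empty y
    obtain ⟨N, hN⟩ := not_forall.1 (fun h => hy (mem_iInter.2 h))
    exact ⟨N, fun n hn h => hN (hD hn h)⟩
  obtain ⟨N, hN⟩ := hlast ⟨p, mem_insert _ _⟩
  let U : ℕ → Set (PsiSpace M) := fun n => toExtension p ⁻¹' D n ∪ ofNat '' Ici n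
  have hU : ∀ n, IsOpen (U n) := by
    intro n A _
    refine (finite_lt_nat n).subset fun k hk => ?_
    by_contra hkn
    exact hk.2 (Or.inr ⟨k, mem_Ici.2 (not_lt.1 hkn), rfl⟩)
  have hUanti : Antitone U := fun m n hmn =>
    union_subset_union (preimage_mono (hD hmn)) (image_mono (Ici_subset_Ici.2 hmn))
  -- The whole space is used until `p` has left `D n`. From then on openness of `X` in the extension
  -- suffices, and the added tails `Ici n` have empty intersection.
  refine ⟨fun n => {y | n < N} ∪ toExtension p '' U n, ?_, ?_, ?_, ?_⟩
  · exact fun m n hmn => union_subset_union (fun _ h => hmn.trans_lt h) (image_mono (hUanti hmn))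
  · exact fun n => isOpen_const.union (hopen _ (hU n))
  · rw [eq_empty_iff_forall_notMem]
    intro y hy
    rw [mem_iInter] at hy
    have hy' : ∀ n, N ≤ n → y ∈ toExtension p '' U n := fun n hn =>
      (hy n).resolve_left (not_lt.2 hn)
    obtain ⟨x, -, rfl⟩ := hy' N le_rfl
    have hx : ∀ n, N ≤ n → x ∈ U n := fun n hn => hinj.mem_set_image.1 (hy' n hn)
    obtain ⟨N', hN'⟩ := hlast (toExtension p x)
    have hx' : ∀ n, N ≤ n → N' ≤ n → x ∈ ofNat '' Ici n := fun n h1 h2 =>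
      (hx n h1).resolve_left (hN' n h2)
    obtain ⟨k, -, rfl⟩ := hx' (max N N') (le_max_left _ _) (le_max_right _ _)
    obtain ⟨k', hk', h⟩ := hx' (max (k + 1) (max N N'))
      ((le_max_left _ _).trans (le_max_right _ _)) ((le_max_right _ _).trans (le_max_right _ _))
    cases h
    have := (le_max_left (k + 1) (max N N')).trans hk'
    omega
  · intro n y hy
    rcases lt_or_ge n N with h | h
    · exact Or.inl h
    · obtain ⟨_, rfl | ⟨x, rfl⟩⟩ := y
      · exact (hN n h hy).elim
      · exact Or.inr ⟨x, Or.inl hy, rfl⟩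

/-- An increasing family of sets of non-isolated points, separated by clopen sets from the rest of
its union `Y`, yields a point of the remainder which is in the closure of `Y` but not of any subset
of a member of the family. -/
theorem exists_remainder_point {W : Type*} [LinearOrder W] [Nonempty W]
    (hM : IsAlmostDisjoint M) (Y : W → Set (PsiSpace M)) (hmono : Monotone Y)
    (hmem : ∀ w, ∀ x ∈ Y w, ∃ A, x = ofMem A)
    (hne : ∀ w, ∃ v, (Y v \ Y w).Nonempty)
    (hclopen : ∀ w, ∃ K, IsClopen K ∧ Y w ⊆ K ∧ Disjoint ((⋃ v, Y v) \ Y w) K) :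
    ∃ p : StoneCech (PsiSpace M), p ∉ range (stoneCechUnit : PsiSpace M → StoneCech (PsiSpace M)) ∧
      p ∈ closure (stoneCechUnit '' ⋃ v, Y v) ∧ ∀ w, p ∉ closure (stoneCechUnit '' Y w) := by
  have hemb := isOpenEmbedding_stoneCechUnit hM
  let F : W → Set (StoneCech (PsiSpace M)) := fun w =>
    closure (stoneCechUnit '' ((⋃ v, Y v) \ Y w))
  have hF : Antitone F := fun v w hvw =>
    closure_mono (image_mono (sdiff_subset_sdiff_right (hmono hvw)))
  obtain ⟨p, hp⟩ : (⋂ w, F w).Nonempty := by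
    refine IsCompact.nonempty_iInter_of_directed_nonempty_isCompact_isClosed F
      hF.directed_ge (fun w => ?_) (fun w => isClosed_closure.isCompact)
      (fun w => isClosed_closure)
    obtain ⟨v, x, hx⟩ := hne w
    exact ⟨_, subset_closure ⟨x, ⟨mem_iUnion.2 ⟨v, hx.1⟩, hx.2⟩, rfl⟩⟩
  rw [mem_iInter] at hp
  refine ⟨p, ?_, closure_mono (image_mono sdiff_subset) (hp (Classical.arbitrary W)), ?_⟩
  · rintro ⟨x, rfl⟩
    -- The neighbourhood `{x} ∪ ℕ` can meet a set of non-isolated points only in `x`.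
    have hx : ∀ w, x ∈ (⋃ v, Y v) \ Y w := by
      intro w
      obtain ⟨_, ⟨y, hy, rfl⟩, z, hz, hzy⟩ := mem_closure_iff.1 (hp w) _
        (hemb.isOpenMap _ (isOpen_insert_range_ofNat x)) ⟨x, mem_insert _ _, rfl⟩
      obtain rfl := hemb.injective hzy
      rcases hy with rfl | ⟨n, rfl⟩
      · exact hz
      · obtain ⟨v, hv⟩ := mem_iUnion.1 hz.1
        obtain ⟨A, hA⟩ := hmem v _ hv
        cases hA
    obtain ⟨v, hv⟩ := mem_iUnion.1 (hx (Classical.arbitrary W)).1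
    exact (hx v).2 hv
  · intro w hw
    obtain ⟨K, hK, h1, h2⟩ := hclopen w
    exact disjoint_left.1 (disjoint_closure_image_stoneCechUnit hK h1 h2) hw (hp w)

end PsiSpace

/-! ### The index set `ω₁` and the conclusion -/

theorem exists_wellOrder_countable_Iio :
    ∃ (W : Type) (_ : LinearOrder W) (_ : WellFoundedLT W),
      (∀ w : W, Countable (Iio w)) ∧ Uncountable W := by
  refine ⟨(Cardinal.aleph 1).ord.ToType, inferInstance, inferInstance, fun w => ?_, ?_⟩
  · have h : Cardinal.mk (Iio w) < Cardinal.aleph 1 := by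
      simpa using Cardinal.mk_Iio_lt w (by simp)
    rw [← Cardinal.mk_le_aleph0_iff, ← Order.lt_succ_iff, Cardinal.succ_aleph0]
    exact h
  · rw [← Cardinal.aleph0_lt_mk_iff, Cardinal.mk_ord_toType]
    exact Cardinal.aleph0_lt_aleph_one

theorem exists_gt_of_countable {W : Type*} [LinearOrder W] (hW : ∀ w : W, Countable (Iio w))
    [Uncountable W] {C : Set W} (hC : C.Countable) : ∃ w, ∀ c ∈ C, c < w := by
  by_contra! h
  refine not_countable_univ (α := W) ((hC.biUnion (t := fun c _ => Iic c) fun c _ => ?_).mono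
    fun w _ => ?_)
  · rw [← Iio_insert]
    exact (to_countable (Iio c)).insert c
  · obtain ⟨c, hc, hwc⟩ := h w
    exact mem_biUnion hc hwc

theorem theorem3p14 :
    ∃ M : Set (Set ℕ), IsMAD M ∧
      ∃ p : StoneCech (PsiSpace M), p ∉ range (stoneCechUnit : PsiSpace M → StoneCech (PsiSpace M)) ∧
        IsPseudocompact (OnePointExtension (PsiSpace M) p) ∧
        IsDeltaSpace (OnePointExtension (PsiSpace M) p) ∧
        ¬ HasCountableTightnessAt (OnePointExtension (PsiSpace M) p)
            ⟨p, mem_insert p (range stoneCechUnit)⟩ := by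
  obtain ⟨W, _, _, hW, _⟩ := exists_wellOrder_countable_Iio
  obtain ⟨B, hB⟩ := exists_tower W hW
  obtain ⟨M, hM, hdec⟩ := exists_isMAD_of_dense (fun A => ∀ w, DecidedBy A (B w))
    fun S hS => exists_subset_decidedBy (fun a b hab => (hB a b hab).1) hS
  have hAD : IsAlmostDisjoint M := hM.prop
  let Y : W → Set (PsiSpace M) := fun w => {x | ∃ A : M, x = .ofMem A ∧ (A.1 \ B w).Finite}
  have hmono : Monotone Y := by
    rintro v w hvw _ ⟨A, rfl, hA⟩
    rcases hvw.eq_or_lt with rfl | hvw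
    · exact ⟨A, rfl, hA⟩
    refine ⟨A, rfl, (hA.union (hB v w hvw).1).subset fun n hn => ?_⟩
    by_cases h : n ∈ B v
    exacts [Or.inr ⟨h, hn.2⟩, Or.inl ⟨hn.1, h⟩]
  have hne : ∀ w, ∃ v, (Y v \ Y w).Nonempty := by
    intro w
    obtain ⟨v, hv⟩ := exists_gt_of_countable hW (countable_singleton w)
    have hwv := hv w rfl
    -- A member meeting `B v \ B w` infinitely is almost contained in `B v`, being decided by it,
    -- but not in `B w`.
    obtain ⟨A, hA, hinf⟩ := hM.exists_inter_infinite (hB w v hwv).2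
    refine ⟨v, .ofMem ⟨A, hA⟩, ⟨⟨A, hA⟩, rfl, ?_⟩, ?_⟩
    · exact (hdec A hA v).resolve_right fun h => hinf (h.subset fun n hn => ⟨hn.1, hn.2.1⟩)
    · rintro ⟨A', h, hf⟩
      cases h
      exact hinf (hf.subset fun n hn => ⟨hn.1, hn.2.2⟩)
  obtain ⟨p, hp, hpY, hpw⟩ := PsiSpace.exists_remainder_point hAD Y hmono
    (fun w x hx => ⟨hx.choose, hx.choose_spec.1⟩) hne fun w =>
      ⟨_, PsiSpace.isClopen_of_decided (B w) fun A hA => hdec A hA w, subset_union_right, by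
        rw [disjoint_left]
        rintro x ⟨hx, hxw⟩ (⟨n, -, rfl⟩ | h)
        · obtain ⟨v, A, hA, -⟩ := mem_iUnion.1 hx
          cases hA
        · exact hxw h⟩
  refine ⟨M, hM, p, hp, PsiSpace.isPseudocompact_extension hM p,
    PsiSpace.isDeltaSpace_extension hAD p, fun htight => ?_⟩
  obtain ⟨C, hCY, hC, hpC⟩ := htight (PsiSpace.toExtension p '' ⋃ w, Y w) (by
    rw [closure_subtype, image_image]
    exact hpY)
  have hlevel : ∀ y ∈ C, ∃ w, ∃ x ∈ Y w, PsiSpace.toExtension p x = y := by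
    intro y hy
    obtain ⟨x, hx, rfl⟩ := hCY hy
    obtain ⟨w, hw⟩ := mem_iUnion.1 hx
    exact ⟨w, x, hw, rfl⟩
  choose! l hl using hlevel
  obtain ⟨w, hw⟩ := exists_gt_of_countable hW (hC.image l)
  refine hpw w (closure_mono ?_ (closure_subtype.1 hpC))
  rintro _ ⟨y, hy, rfl⟩
  obtain ⟨x, hx, rfl⟩ := hl y hy
  exact ⟨x, hmono (hw _ ⟨_, hy, rfl⟩).le hx, rfl⟩
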